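/- Let $n\ge 0$ and let $P$ be a set of $n$ points in the Euclidean plane in strictly convex position (that is, no point of $P$ lies in the convex hull of the other points of $P$). Let $D_n$ be the graph whose vertices are the closed line segments with two distinct endpoints in $P$, where two vertices are adjacent if and only if the corresponding segments are disjoint as sets of points. Then $$\chi(D_n)=n-\left\lfloor\sqrt{2n+\tfrac14}-\tfrac12\right\rfloor .$$ Equivalently, $\chi(D_n)=n-k$, where $k$ is the unique non-negative integer satisfying $\binom{k+1}{2}\le n<\binom{k+2}{2}$. -/

import Mathlib

/-- The Euclidean plane. -/
abbrev Plane : Type := EuclideanSpace ℝ (Fin 2)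

/-- A finite set of points in the plane is in strictly convex position if no point of it lies in
the convex hull of the others, i.e. each of its points is a vertex of its convex hull. -/
def StrictlyConvexPosition (P : Finset Plane) : Prop :=
  ∀ p ∈ P, p ∉ convexHull ℝ ((P : Set Plane) \ {p})

/-- The line segments, as (closed) subsets of the plane, whose two distinct endpoints lie
in `P`. -/
def SegmentsOn (P : Finset Plane) : Type :=
  {s : Set Plane // ∃ a ∈ P, ∃ b ∈ P, a ≠ b ∧ s = segment ℝ a b}

/-- The segment disjointness graph of `P`: its vertices are the segments with endpoints in `P`,
and two of them are adjacent if they are disjoint as sets of points. -/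
def segmentDisjointnessGraph (P : Finset Plane) : SimpleGraph (SegmentsOn P) where
  Adj s t := Disjoint s.1 t.1
  symm := ⟨fun _ _ h => h.symm⟩
  loopless := ⟨by
    rintro ⟨s, a, _, b, _, _, rfl⟩ h
    exact Set.disjoint_left.mp h (left_mem_segment ℝ a b) (left_mem_segment ℝ a b)⟩

/-!
Label the points `0, …, n - 1` in counterclockwise order. Two segments are disjoint if and only if
their ends are four distinct points that do not alternate around the polygon, so everything is about
chords of an `n`-gon. A colour class is a set of pairwise intersecting chords. Let `m` be the integer
with `tri m ≤ n < tri (m + 1)`, where `tri m = 0 + 1 + ⋯ + m`.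

**Upper bound.** Split the vertices into consecutive groups of sizes `1, 2, 3, …`, the last one
possibly incomplete. Every vertex `a` that is not last in its group is a colour; there are `n - m` of
them. The class of `a` is part of a triangle with pendant edges: the triangle is formed by `a`,
`a + 1` and the last vertex `z` of a suitable earlier group, and the pendant edges join `a` to the
vertices between `a + 1` and `z` and `a + 1` to the vertices between `z` and `a`. Such chords pairwise
meet (`HasColour.meet`), and with the right choice of `z` these classes contain all chords
(`exists_hasColour`).

**Lower bound.** Index vertices periodically by `ℤ` and represent a chord by `i < j < i + n`, where
`(i, j)` and `(j, i + n)` are the same chord: chords form a Möbius strip. Two chords intersect exactly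
when all their representatives are comparable in the product order of `ℤ × ℤ`. In the coordinates
`t = i + j`, `x = j - i` a colour class is then part of a loop `f : ℤ → ℤ` with steps `± 1` and
`f (t + n) = n - f t` (`exists_isLoop_through`), and two loops always meet (`IsLoop.exists_eq`).

So `k` colours give `k` loops through all points of the strip. If no point were on three loops, each
pair of loops would have a meeting point of its own, and counting points with multiplicity would give
`n.choose 2 + k.choose 2 ≤ n * k`, that is `tri (n - k) ≤ n` and `n - k ≤ m`. For this it suffices
that no two loops share a step (`LoopFamily.choose_two_bound_of_edgeDisjoint`). That can be arranged
when `k ≤ n`: take a covering family of loops whose total pairwise distance is maximal. If two loops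
share a step, consider their maximal common straight run. The loop that turns into it at its start
can be pushed to one side, the loop that turns off at its end can be pushed to the other side, and
in both cases everything remains covered by the other loop. The sum of the two changes of the total
distance is positive, contradicting maximality (`LoopFamily.not_common_up_step`).
-/

open Finset

/-! ### Loops on the strip of chords -/

/-- A loop on the Möbius strip of chords: the lattice path visiting, at each time `t`, the chord
with `i + j = t` and `j - i = f t`. Consecutive chords share an endpoint, and `anti` says that the
path is compatible with the identification of `(i, j)` and `(j, i + n)`. The values `0` and `n`,
which belong to no chord, are allowed: this way no boundary obstructs pushing a loop aside. -/
structure IsLoop (n : ℤ) (f : ℤ → ℤ) : Prop where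
  step : ∀ t, f (t + 1) = f t + 1 ∨ f (t + 1) = f t - 1
  anti : ∀ t, f (t + n) = n - f t
  parity : ∀ t, (2 : ℤ) ∣ f t - t

namespace IsLoop

variable {n : ℤ} {f g : ℤ → ℤ}

theorem abs_sub_le (hf : IsLoop n f) (t : ℤ) (j : ℕ) : |f (t + j) - f t| ≤ j := by
  induction j with
  | zero => simp
  | succ j ih =>
    have h := hf.step (t + j)
    rw [abs_le] at ih ⊢
    push_cast
    rw [← add_assoc]
    omega

/-- A loop stays in the strip, since it moves by `n - 2 * f t` in `n` unit steps. -/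
theorem nonneg_and_le (hf : IsLoop n f) (hn : 0 ≤ n) (t : ℤ) : 0 ≤ f t ∧ f t ≤ n := by
  have h := hf.abs_sub_le t n.toNat
  rw [Int.toNat_of_nonneg hn, hf.anti, abs_le] at h
  omega

/-- Two loops meet within each period: their difference changes sign, in steps of `0` or `± 2`
and through even values. -/
theorem exists_eq (hf : IsLoop n f) (hg : IsLoop n g) (hn : 0 < n) :
    ∃ t, 0 ≤ t ∧ t < n ∧ f t = g t := by
  by_contra! hne
  have hne' : ∀ t, 0 ≤ t → t ≤ n → f t ≠ g t := by
    intro t h0 h1 h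
    rcases h1.lt_or_eq with h1 | rfl
    · exact hne t h0 h1 h
    · have h1 := hf.anti 0
      have h2 := hg.anti 0
      have h3 := hne 0 le_rfl hn
      rw [zero_add] at h1 h2
      omega
  have key : ∀ j : ℕ, (j : ℤ) ≤ n → ((0 < f j - g j) ↔ (0 < f 0 - g 0)) := by
    intro j
    induction j with
    | zero => simp
    | succ j ih =>
      intro hj
      push_cast at hj ⊢
      have h1 := ih (by omega)
      have h2 := hf.step j
      have h3 := hg.step j
      have h4 := hf.parity j
      have h5 := hg.parity j
      have h6 := hne' j (by omega) (by omega)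
      have h7 := hne' (j + 1) (by omega) (by omega)
      rw [← h1]
      omega
  have h := key n.toNat (by omega)
  rw [Int.toNat_of_nonneg hn.le] at h
  have h1 := hf.anti 0
  have h2 := hg.anti 0
  have h3 := hne 0 le_rfl hn
  rw [zero_add] at h1 h2
  omega

end IsLoop

/-- A lattice path on a window of length `n` whose end matches its start under the identification
of the Möbius strip extends to a loop. -/
theorem exists_isLoop_of_window {n S : ℤ} (hn : 0 < n) (h : ℤ → ℤ)
    (hstep : ∀ t, S ≤ t → t < S + n → h (t + 1) = h t + 1 ∨ h (t + 1) = h t - 1)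
    (hend : h (S + n) = n - h S) (hpar : ∀ t, S ≤ t → t < S + n → (2 : ℤ) ∣ h t - t) :
    ∃ f, IsLoop n f ∧ ∀ t, S ≤ t → t ≤ S + n → f t = h t := by
  classical
  let f : ℤ → ℤ := fun t =>
    if Even ((t - S) / n) then h (S + (t - S) % n) else n - h (S + (t - S) % n)
  have hf : ∀ q u, 0 ≤ u → u < n →
      f (S + n * q + u) = if Even q then h (S + u) else n - h (S + u) := by
    intro q u hu hun
    have e : S + n * q + u - S = u + n * q := by ring
    have e1 : (u + n * q) / n = q := by
      rw [Int.add_mul_ediv_left _ _ hn.ne', Int.ediv_eq_zero_of_lt hu hun, zero_add]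
    have e2 : (u + n * q) % n = u := by
      rw [Int.add_mul_emod_self_left, Int.emod_eq_of_lt hu hun]
    simp only [f, e, e1, e2]
  have hrep : ∀ t, ∃ q u, 0 ≤ u ∧ u < n ∧ t = S + n * q + u := fun t =>
    ⟨(t - S) / n, (t - S) % n, Int.emod_nonneg _ hn.ne', Int.emod_lt_of_pos _ hn, by
      have := Int.mul_ediv_add_emod (t - S) n
      linarith⟩
  refine ⟨f, ⟨?_, ?_, ?_⟩, ?_⟩
  · intro t
    obtain ⟨q, u, hu, hun, rfl⟩ := hrep t
    rw [hf q u hu hun]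
    have hs := hstep (S + u) (by omega) (by omega)
    rcases lt_or_ge (u + 1) n with h1 | h1
    · rw [show S + n * q + u + 1 = S + n * q + (u + 1) by ring, hf q (u + 1) (by omega) h1]
      rw [add_assoc] at hs
      split_ifs <;> omega
    · obtain rfl : n = u + 1 := by omega
      rw [show S + (u + 1) * q + u + 1 = S + (u + 1) * (q + 1) + 0 by ring,
        hf (q + 1) 0 le_rfl hn, add_zero]
      rw [add_assoc] at hs
      rcases Int.even_or_odd q with hq | hq
      · rw [if_pos hq, if_neg (by simpa [Int.even_add_one] using hq)]
        omega
      · rw [if_neg (Int.not_even_iff_odd.2 hq), if_pos hq.add_one]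
        omega
  · intro t
    obtain ⟨q, u, hu, hun, rfl⟩ := hrep t
    rw [hf q u hu hun, show S + n * q + u + n = S + n * (q + 1) + u by ring, hf _ u hu hun]
    rcases Int.even_or_odd q with hq | hq
    · rw [if_pos hq, if_neg (by simpa [Int.even_add_one] using hq)]
    · rw [if_neg (Int.not_even_iff_odd.2 hq), if_pos hq.add_one]
      omega
  · intro t
    obtain ⟨q, u, hu, hun, rfl⟩ := hrep t
    rw [hf q u hu hun]
    obtain ⟨d, hd⟩ := hpar (S + u) (by omega) (by omega)
    rcases Int.even_or_odd q with hq | hq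
    · rw [if_pos hq]
      obtain ⟨w, rfl⟩ := hq
      exact ⟨d - n * w, by linear_combination hd⟩
    · rw [if_neg (Int.not_even_iff_odd.2 hq)]
      obtain ⟨w, rfl⟩ := hq
      exact ⟨-d - n * w - S - u, by linear_combination -hd⟩
  · intro t h1 h2
    rcases h2.lt_or_eq with h2 | rfl
    · have := hf 0 (t - S) (by omega) (by omega)
      simpa using this
    · have := hf 1 0 le_rfl hn
      rw [if_neg (by decide)] at this
      rw [hend]
      simpa using this

/-- Pairwise comparable points lie on a common loop. Comparability makes `T` the graph of a partial
`1`-Lipschitz function, which is extended by the infimal convolution `U`; `U` is the right loop on a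
window that starts at a point of `T`. -/
theorem exists_isLoop_through {n : ℤ} (hn : 0 < n) (T : Set (ℤ × ℤ))
    (hpar : ∀ p ∈ T, (2 : ℤ) ∣ p.2 - p.1) (hnext : ∀ p ∈ T, (p.1 + n, n - p.2) ∈ T)
    (hprev : ∀ p ∈ T, (p.1 - n, n - p.2) ∈ T)
    (hcomp : ∀ p ∈ T, ∀ q ∈ T, |p.2 - q.2| ≤ |p.1 - q.1|) :
    ∃ f, IsLoop n f ∧ ∀ p ∈ T, f p.1 = p.2 := by
  rcases T.eq_empty_or_nonempty with rfl | ⟨⟨S, y₀⟩, h₀⟩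
  · obtain ⟨f, hf, -⟩ := exists_isLoop_of_window (S := 0) hn (fun t => t)
      (fun t _ _ => Or.inl rfl) (by simp) (fun t _ _ => by simp)
    exact ⟨f, hf, by simp⟩
  have hU : ∀ t : ℤ, ∃ u : ℤ, (∃ p ∈ T, u = p.2 + |t - p.1|) ∧ ∀ p ∈ T, u ≤ p.2 + |t - p.1| := by
    intro t
    obtain ⟨u, ⟨p, hp, hu⟩, hmin⟩ := Int.exists_least_of_bdd
      (P := fun u => ∃ p ∈ T, u = p.2 + |t - p.1|)
      ⟨y₀ - |t - S|, by
        rintro _ ⟨p, hp, rfl⟩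
        have h1 := hcomp _ h₀ p hp
        have h2 := abs_sub_le S t p.1
        have h3 := le_abs_self (y₀ - p.2)
        rw [abs_sub_comm S t] at h2
        simp only at h1
        linarith⟩
      ⟨_, (S, y₀), h₀, rfl⟩
    exact ⟨u, ⟨p, hp, hu⟩, fun q hq => hmin _ ⟨q, hq, rfl⟩⟩
  choose U hU1 hU2 using hU
  have hUT : ∀ p ∈ T, U p.1 = p.2 := by
    intro p hp
    apply le_antisymm
    · simpa using hU2 p.1 p hp
    · obtain ⟨q, hq, h⟩ := hU1 p.1
      rw [h]
      have h1 := hcomp p hp q hq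
      have h2 := le_abs_self (p.2 - q.2)
      linarith
  have hUpar : ∀ t, (2 : ℤ) ∣ U t - t := by
    intro t
    obtain ⟨q, hq, h⟩ := hU1 t
    have := hpar q hq
    rcases abs_cases (t - q.1) with h1 | h1 <;> omega
  have hUstep : ∀ t, U (t + 1) = U t + 1 ∨ U (t + 1) = U t - 1 := by
    intro t
    obtain ⟨q, hq, h⟩ := hU1 t
    obtain ⟨r, hr, h'⟩ := hU1 (t + 1)
    have h1 := hU2 (t + 1) q hq
    have h2 := hU2 t r hr
    have h3 := hUpar t
    have h4 := hUpar (t + 1)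
    have h5 : |t + 1 - q.1| ≤ |t - q.1| + 1 := by
      rw [show t + 1 - q.1 = t - q.1 + 1 by ring]
      simpa using abs_add_le (t - q.1) 1
    have h6 : |t - r.1| ≤ |t + 1 - r.1| + 1 := by
      rw [show t - r.1 = t + 1 - r.1 + -1 by ring]
      simpa using abs_add_le (t + 1 - r.1) (-1)
    omega
  obtain ⟨f, hf, hfU⟩ := exists_isLoop_of_window (S := S) hn U (fun t _ _ => hUstep t)
    (by rw [hUT _ (hnext _ h₀), hUT _ h₀]) (fun t _ _ => hUpar t)
  refine ⟨f, hf, ?_⟩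
  have hwin : ∀ t, S ≤ t → t ≤ S + n → ∀ y, (t, y) ∈ T → f t = y := fun t h1 h2 y hy => by
    rw [hfU t h1 h2]; exact hUT _ hy
  have hup : ∀ j : ℕ, ∀ t, S ≤ t → t ≤ S + n + n * j → ∀ y, (t, y) ∈ T → f t = y := by
    intro j
    induction j with
    | zero => intro t h1 h2; exact hwin t h1 (by simpa using h2)
    | succ j ih =>
      intro t h1 h2 y hy
      rcases le_or_gt t (S + n) with h3 | h3
      · exact hwin t h1 h3 y hy
      · have h4 := ih (t - n) (by linarith) (by push_cast at h2; linarith) _ (hprev _ hy)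
        have h5 := hf.anti (t - n)
        rw [sub_add_cancel] at h5
        linarith
  have hdown : ∀ j : ℕ, ∀ t, S - n * j ≤ t → t ≤ S + n → ∀ y, (t, y) ∈ T → f t = y := by
    intro j
    induction j with
    | zero => intro t h1 h2; exact hwin t (by simpa using h1) h2
    | succ j ih =>
      intro t h1 h2 y hy
      rcases le_or_gt S t with h3 | h3
      · exact hwin t h3 h2 y hy
      · have h4 := ih (t + n) (by push_cast at h1; linarith) (by linarith) _ (hnext _ hy)
        have h5 := hf.anti t
        linarith
  rintro ⟨t, y⟩ hy
  rcases le_total S t with h | h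
  · refine hup (t - S).toNat t h ?_ y hy
    rw [Int.toNat_of_nonneg (by omega)]
    nlinarith
  · refine hdown (S - t).toNat t ?_ (by omega) y hy
    rw [Int.toNat_of_nonneg (by omega)]
    nlinarith

/-! ### Families of loops of maximal spread -/

namespace LoopFamily

variable {n : ℤ} {k : ℕ}

/-- The loops of `F` pass through all points `(i + j, j - i)` with `i < j < i + n`. -/
def Covers (n : ℤ) (F : Fin k → ℤ → ℤ) : Prop :=
  ∀ t x, 0 < x → x < n → (2 : ℤ) ∣ x - t → ∃ a, F a t = x

/-- The total pairwise distance of the loops of `F` over one period. -/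
noncomputable def spread (n : ℤ) (F : Fin k → ℤ → ℤ) : ℤ :=
  ∑ r ∈ Ico 0 n, ∑ a, ∑ b, |F a r - F b r|

theorem sum_Ico_eq_of_periodic {G : ℤ → ℤ} (hG : ∀ t, G (t + n) = G t) (hn : 0 < n) (s : ℤ) :
    ∑ r ∈ Ico s (s + n), G r = ∑ r ∈ Ico 0 n, G r := by
  have hstep : ∀ s, ∑ r ∈ Ico (s + 1) (s + 1 + n), G r = ∑ r ∈ Ico s (s + n), G r := by
    intro s
    have h1 : Ico s (s + n) = insert s (Ico (s + 1) (s + n)) := by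
      ext x; simp only [mem_Ico, mem_insert]; omega
    have h2 : Ico (s + 1) (s + 1 + n) = insert (s + n) (Ico (s + 1) (s + n)) := by
      ext x; simp only [mem_Ico, mem_insert]; omega
    rw [h1, h2, sum_insert (by simp), sum_insert (by simp), hG]
  induction s using Int.induction_on with
  | zero => simp
  | succ i ih => rw [hstep, ih]
  | pred i ih => rw [← hstep, sub_add_cancel, ih]

theorem sum_Ico_append (G : ℤ → ℤ) {a b c : ℤ} (hab : a ≤ b) (hbc : b ≤ c) :
    ∑ r ∈ Ico a c, G r = ∑ r ∈ Ico a b, G r + ∑ r ∈ Ico b c, G r := by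
  rw [← Ico_union_Ico_eq_Ico hab hbc, sum_union (Ico_disjoint_Ico_consecutive a b c)]

theorem spread_eq_sum_window {F : Fin k → ℤ → ℤ} (hF : ∀ a, IsLoop n (F a)) (hn : 0 < n) (s : ℤ) :
    spread n F = ∑ r ∈ Ico s (s + n), ∑ a, ∑ b, |F a r - F b r| := by
  refine (sum_Ico_eq_of_periodic (fun t => ?_) hn s).symm
  refine sum_congr rfl fun a _ => sum_congr rfl fun b _ => ?_
  rw [(hF a).anti, (hF b).anti, ← abs_neg]
  congr 1
  ring

theorem exists_max_spread {F₀ : Fin k → ℤ → ℤ} (hn : 0 ≤ n) (hF₀ : ∀ a, IsLoop n (F₀ a))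
    (hc₀ : Covers n F₀) :
    ∃ F : Fin k → ℤ → ℤ, (∀ a, IsLoop n (F a)) ∧ Covers n F ∧
      ∀ F' : Fin k → ℤ → ℤ, (∀ a, IsLoop n (F' a)) → Covers n F' → spread n F' ≤ spread n F := by
  obtain ⟨_, ⟨F, hF, hc, rfl⟩, hmax⟩ := Int.exists_greatest_of_bdd
    (P := fun w => ∃ F : Fin k → ℤ → ℤ, (∀ a, IsLoop n (F a)) ∧ Covers n F ∧ w = spread n F)
    ⟨∑ r ∈ Ico 0 n, ∑ a : Fin k, ∑ b : Fin k, n, by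
      rintro _ ⟨F, hF, -, rfl⟩
      refine sum_le_sum fun r _ => sum_le_sum fun a _ => sum_le_sum fun b _ => ?_
      have h1 := (hF a).nonneg_and_le hn r
      have h2 := (hF b).nonneg_and_le hn r
      rw [abs_le]
      omega⟩
    ⟨_, F₀, hF₀, hc₀, rfl⟩
  exact ⟨F, hF, hc, fun F' hF' hc' => hmax _ ⟨F', hF', hc', rfl⟩⟩

/-- Moving the point `x c` up by `2` increases its distance to the points at or below it and
decreases its distance to the others, which are at distance at least `2`. -/
theorem sum_abs_sub_update (x : Fin k → ℤ) (c : Fin k) (hx : ∀ a b, (2 : ℤ) ∣ x a - x b) :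
    ∑ a, ∑ b, |Function.update x c (x c + 2) a - Function.update x c (x c + 2) b| =
      ∑ a, ∑ b, |x a - x b| + 4 * (2 * (#{b | x b ≤ x c} : ℤ) - 1 - k) := by
  let s : Fin k → ℤ := fun b => (if x b ≤ x c then 2 else -2) - if b = c then 2 else 0
  have hs : ∑ b, s b = 2 * (2 * (#{b | x b ≤ x c} : ℤ) - 1 - k) := by
    have h1 : ∀ b, s b = 4 * (if x b ≤ x c then 1 else 0) - 2 - if b = c then 2 else 0 := by
      intro b; simp only [s]; split_ifs <;> ring
    simp only [h1, sum_sub_distrib, ← mul_sum, sum_boole, sum_ite_eq', mem_univ, if_true,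
      sum_const, card_univ, Fintype.card_fin]
    simp
    ring
  have hpt : ∀ a b, |Function.update x c (x c + 2) a - Function.update x c (x c + 2) b| =
      |x a - x b| + ((if a = c then s b else 0) + if b = c then s a else 0) := by
    intro a b
    simp only [s, Function.update_apply]
    have h1 := hx a c
    have h2 := hx b c
    by_cases ha : a = c <;> by_cases hb : b = c
    · simp [ha, hb]
    · subst ha
      simp only [hb, if_true, if_false]
      split_ifs
      · rw [abs_of_nonneg (by omega), abs_of_nonneg (by omega)]; ring
      · rw [abs_of_nonpos (by omega), abs_of_nonpos (by omega)]; ring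
    · subst hb
      simp only [ha, if_true, if_false]
      split_ifs
      · rw [abs_of_nonpos (by omega), abs_of_nonpos (by omega)]; ring
      · rw [abs_of_nonneg (by omega), abs_of_nonneg (by omega)]; ring
    · simp [ha, hb]
  simp only [hpt, sum_add_distrib]
  have h1 : ∑ a, ∑ b, (if a = c then s b else 0) = ∑ b, s b := by
    rw [sum_comm]; simp
  have h2 : ∑ a, ∑ b, (if b = c then s a else 0) = ∑ b, s b := by simp
  rw [h1, h2, hs]
  ring

/-- If the points of the loop `c` at the times in `[A, B)` all lie on other loops as well, and `c`
comes down to the first of them and goes up from the last, then pushing `c` up by `2` at these times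
gives another covering family of loops. Maximality of the spread bounds the change. -/
theorem sum_push_le_zero {F : Fin k → ℤ → ℤ} (hn : 0 < n) (hF : ∀ a, IsLoop n (F a))
    (hc : Covers n F)
    (hmax : ∀ F' : Fin k → ℤ → ℤ, (∀ a, IsLoop n (F' a)) → Covers n F' → spread n F' ≤ spread n F)
    {c : Fin k} {A B : ℤ} (hAB : A < B) (hBA : B ≤ A + n - 1) (hA : F c (A - 1) = F c A + 1)
    (hB : F c B = F c (B - 1) + 1) (hmult : ∀ r, A ≤ r → r < B → ∃ b, b ≠ c ∧ F b r = F c r) :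
    ∑ r ∈ Ico A B, (2 * (#{b | F b r ≤ F c r} : ℤ) - 1 - k) ≤ 0 := by
  obtain ⟨f, hf, hfw⟩ := exists_isLoop_of_window (S := A - 1) hn
    (fun r => if A ≤ r ∧ r < B then F c r + 2 else F c r)
    (by
      intro t h1 h2
      have h3 := (hF c).step t
      by_cases hA' : t = A - 1
      · subst hA'
        rw [sub_add_cancel] at h3 ⊢
        rw [if_pos ⟨le_rfl, hAB⟩, if_neg (by omega)]
        omega
      by_cases hB' : t = B - 1
      · subst hB'
        rw [sub_add_cancel] at h3 ⊢
        rw [if_neg (by omega), if_pos (by omega)]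
        omega
      · split_ifs <;> omega)
    (by
      rw [if_neg (by omega), if_neg (by omega), (hF c).anti])
    (by
      intro t _ _
      have := (hF c).parity t
      split_ifs <;> omega)
  have hf1 : ∀ r, A ≤ r → r < B → f r = F c r + 2 := fun r h1 h2 => by
    rw [hfw r (by omega) (by omega), if_pos ⟨h1, h2⟩]
  have hf2 : ∀ r, B ≤ r → r < A + n → f r = F c r := fun r h1 h2 => by
    rw [hfw r (by omega) (by omega), if_neg (by omega)]
  have hF' : ∀ a, IsLoop n (Function.update F c f a) := by
    intro a
    rw [Function.update_apply]
    split_ifs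
    exacts [hf, hF a]
  have hwin : ∀ r, A ≤ r → r < A + n → ∀ a, ∃ b, Function.update F c f b r = F a r := by
    intro r h1 h2 a
    by_cases ha : a = c
    · subst ha
      rcases lt_or_ge r B with h3 | h3
      · obtain ⟨b, hb, hbr⟩ := hmult r h1 h3
        exact ⟨b, by rw [Function.update_of_ne hb, hbr]⟩
      · exact ⟨a, by rw [Function.update_self, hf2 r h3 h2]⟩
    · exact ⟨a, by rw [Function.update_of_ne ha]⟩
  -- Whether the new family covers the points of the old one at time `r` depends on `r` modulo `n`.
  have hall : ∀ r a, ∃ b, Function.update F c f b r = F a r := by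
    intro r a
    have hshift : ∀ t, (∃ b, Function.update F c f b (t + n) = F a (t + n)) ↔
        ∃ b, Function.update F c f b t = F a t := by
      intro t
      simp only [(hF' _).anti, (hF a).anti, sub_right_inj]
    have hshift' : ∀ q : ℤ, ∀ t, (∃ b, Function.update F c f b (t + n * q) = F a (t + n * q)) ↔
        ∃ b, Function.update F c f b t = F a t := by
      intro q t
      induction q using Int.induction_on with
      | zero => simp
      | succ i ih => rw [mul_add, mul_one, ← add_assoc, hshift, ih]
      | pred i ih =>
        rw [← hshift, show t + n * (-i - 1) + n = t + n * -i by ring, ih]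
    have h := hwin (A + (r - A) % n) (by have := Int.emod_nonneg (r - A) hn.ne'; omega)
      (by have := Int.emod_lt_of_pos (r - A) hn; omega) a
    rw [← hshift' ((r - A) / n)] at h
    have e := Int.emod_add_mul_ediv (r - A) n
    rwa [show A + (r - A) % n + n * ((r - A) / n) = r by linarith] at h
  have hc' : Covers n (Function.update F c f) := by
    intro t x h1 h2 h3
    obtain ⟨a, rfl⟩ := hc t x h1 h2 h3
    exact hall t a
  have hle := hmax _ hF' hc'
  rw [spread_eq_sum_window hF hn A, spread_eq_sum_window hF' hn A,
    sum_Ico_append _ hAB.le (show B ≤ A + n by omega),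
    sum_Ico_append _ hAB.le (show B ≤ A + n by omega)] at hle
  have e1 : ∑ r ∈ Ico B (A + n), ∑ a, ∑ b,
      |Function.update F c f a r - Function.update F c f b r| =
      ∑ r ∈ Ico B (A + n), ∑ a, ∑ b, |F a r - F b r| := by
    refine sum_congr rfl fun r hr => ?_
    rw [mem_Ico] at hr
    have : ∀ a, Function.update F c f a r = F a r := by
      intro a
      rw [Function.update_apply]
      split_ifs with h
      · rw [h, hf2 r hr.1 hr.2]
      · rfl
    simp only [this]
  have e2 : ∑ r ∈ Ico A B, ∑ a, ∑ b,
      |Function.update F c f a r - Function.update F c f b r| =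
      ∑ r ∈ Ico A B, ∑ a, ∑ b, |F a r - F b r| +
        4 * ∑ r ∈ Ico A B, (2 * (#{b | F b r ≤ F c r} : ℤ) - 1 - k) := by
    rw [mul_sum, ← sum_add_distrib]
    refine sum_congr rfl fun r hr => ?_
    rw [mem_Ico] at hr
    rw [← sum_abs_sub_update (fun a => F a r) c (fun a b => by
      have h1 := (hF a).parity r
      have h2 := (hF b).parity r
      omega)]
    have : ∀ a, Function.update F c f a r =
        Function.update (fun a => F a r) c (F c r + 2) a := by
      intro a
      rw [Function.update_apply, Function.update_apply]
      split_ifs with h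
      · exact hf1 r hr.1 hr.2
      · rfl
    simp only [this]
  rw [e1, e2] at hle
  linarith

/-- Every loop is weakly below the start of an upward step of `a` or weakly above its end, and the
loops using that step are both. -/
theorem add_two_le_card_add_card {F : Fin k → ℤ → ℤ} (hF : ∀ a, IsLoop n (F a)) {a b : Fin k}
    (hab : a ≠ b) {r : ℤ} (h : F a r = F b r) (ha : F a (r + 1) = F a r + 1)
    (hb : F b (r + 1) = F a r + 1) :
    k + 2 ≤ #{c | F c r ≤ F a r} + #{c | F a (r + 1) ≤ F c (r + 1)} := by
  classical
  rw [← card_union_add_card_inter]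
  have h1 : (univ : Finset (Fin k)) ⊆
      ({c | F c r ≤ F a r} : Finset _) ∪ ({c | F a (r + 1) ≤ F c (r + 1)} : Finset _) := by
    intro c _
    simp only [mem_union, mem_filter, mem_univ, true_and]
    have h1 := (hF c).parity r
    have h2 := (hF a).parity r
    have h3 := (hF c).step r
    omega
  have h2 : ({a, b} : Finset (Fin k)) ⊆
      ({c | F c r ≤ F a r} : Finset _) ∩ ({c | F a (r + 1) ≤ F c (r + 1)} : Finset _) := by
    intro c hc
    simp only [mem_insert, mem_singleton] at hc
    simp only [mem_inter, mem_filter, mem_univ, true_and]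
    rcases hc with rfl | rfl <;> omega
  have h3 := card_le_card h1
  have h4 := card_le_card h2
  rw [card_pair hab] at h4
  rw [card_univ, Fintype.card_fin] at h3
  omega

/-- Pushing down is pushing up one period later. -/
theorem sum_push_down_le_zero {F : Fin k → ℤ → ℤ} (hn : 0 < n) (hF : ∀ a, IsLoop n (F a))
    (hc : Covers n F)
    (hmax : ∀ F' : Fin k → ℤ → ℤ, (∀ a, IsLoop n (F' a)) → Covers n F' → spread n F' ≤ spread n F)
    {c : Fin k} {A B : ℤ} (hAB : A < B) (hBA : B ≤ A + n - 1) (hA : F c A = F c (A - 1) + 1)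
    (hB : F c (B - 1) = F c B + 1) (hmult : ∀ r, A ≤ r → r < B → ∃ b, b ≠ c ∧ F b r = F c r) :
    ∑ r ∈ Ico A B, (2 * (#{b | F c r ≤ F b r} : ℤ) - 1 - k) ≤ 0 := by
  have e : ∀ b r, F b r = n - F b (r + n) := fun b r => by rw [(hF b).anti]; ring
  have h := sum_push_le_zero hn hF hc hmax (c := c) (A := A + n) (B := B + n) (by omega) (by omega)
    (by rw [show A + n - 1 = A - 1 + n by ring, (hF c).anti, (hF c).anti]; omega)
    (by rw [show B + n - 1 = B - 1 + n by ring, (hF c).anti, (hF c).anti]; omega)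
    (by
      intro r h1 h2
      obtain ⟨b, hb, hbr⟩ := hmult (r - n) (by omega) (by omega)
      rw [e, e c, sub_add_cancel] at hbr
      exact ⟨b, hb, by omega⟩)
  rw [← Finset.map_add_right_Ico, sum_map] at h
  simp only [addRightEmbedding_apply] at h
  simpa only [(hF _).anti, sub_le_sub_iff_left] using h

/-- In a covering family of maximal spread no two loops share an upward step. Otherwise consider
their maximal common upward run. One of the two can be pushed up along the run and one can be pushed
down along it, and the two pushes together increase the spread. -/
theorem not_common_up_step {F : Fin k → ℤ → ℤ} (hn : 2 ≤ n) (hkn : (k : ℤ) ≤ n)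
    (hF : ∀ a, IsLoop n (F a)) (hc : Covers n F)
    (hmax : ∀ F' : Fin k → ℤ → ℤ, (∀ a, IsLoop n (F' a)) → Covers n F' → spread n F' ≤ spread n F)
    {a b : Fin k} (hab : a ≠ b) (t : ℤ) :
    ¬ (F a t = F b t ∧ F a (t + 1) = F a t + 1 ∧ F b (t + 1) = F a t + 1) := by
  classical
  intro ht
  let R : ℤ → Prop := fun r => F a r = F b r ∧ F a (r + 1) = F a r + 1 ∧ F b (r + 1) = F a r + 1
  have hRn : ∀ r, R r → ¬ R (r + n) := by
    rintro r ⟨-, h1, -⟩ ⟨-, h2, -⟩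
    rw [show r + n + 1 = r + 1 + n by ring, (hF a).anti, (hF a).anti] at h2
    omega
  have hlo : ∃ j : ℕ, ¬ R (t - 1 - j) := ⟨(n - 1).toNat, fun h => hRn _ h (by
    rw [Int.toNat_of_nonneg (by omega), show t - 1 - (n - 1) + n = t by ring]; exact ht)⟩
  have hhi : ∃ j : ℕ, ¬ R (t + 1 + j) := ⟨(n - 1).toNat, by
    rw [Int.toNat_of_nonneg (by omega), show t + 1 + (n - 1) = t + n by ring]; exact hRn _ ht⟩
  obtain ⟨S, hSt, hS, hS'⟩ : ∃ S, S ≤ t ∧ ¬ R (S - 1) ∧ ∀ r, S ≤ r → r < t → R r := by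
    refine ⟨t - Nat.find hlo, by omega, ?_, fun r h1 h2 => ?_⟩
    · have := Nat.find_spec hlo
      rwa [show t - (Nat.find hlo : ℤ) - 1 = t - 1 - (Nat.find hlo : ℤ) by ring]
    · have := Nat.find_min hlo (m := (t - 1 - r).toNat) (by omega)
      rw [not_not, Int.toNat_of_nonneg (by omega)] at this
      simpa using this
  obtain ⟨E, htE, hE, hE'⟩ : ∃ E, t < E ∧ ¬ R E ∧ ∀ r, t < r → r < E → R r := by
    refine ⟨t + 1 + Nat.find hhi, by omega, Nat.find_spec hhi, fun r h1 h2 => ?_⟩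
    have := Nat.find_min hhi (m := (r - t - 1).toNat) (by omega)
    rw [not_not, Int.toNat_of_nonneg (by omega), show t + 1 + (r - t - 1) = r by ring] at this
    exact this
  have hR : ∀ r, S ≤ r → r < E → R r := by
    intro r h1 h2
    rcases lt_trichotomy r t with h | h | h
    exacts [hS' r h1 h, h ▸ ht, hE' r h h2]
  have hlen : E - S ≤ n := by
    by_contra! h
    exact hRn S (hR S le_rfl (by omega)) (hR _ (by omega) (by omega))
  have heq : ∀ r, S ≤ r → r ≤ E → F a r = F b r := by
    intro r h1 h2
    rcases h2.lt_or_eq with h | rfl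
    · exact (hR r h1 h).1
    · obtain ⟨-, h3, h4⟩ := hR (r - 1) (by omega) (by omega)
      rw [sub_add_cancel] at h3 h4
      rw [h3, h4]
  have hup : ∀ c, c = a ∨ c = b → ∀ r, S ≤ r → r < E → F c (r + 1) = F c r + 1 := by
    rintro c (rfl | rfl) r h1 h2
    · exact (hR r h1 h2).2.1
    · rw [(hR r h1 h2).2.2, (hR r h1 h2).1]
  have hother : ∀ c, c = a ∨ c = b → ∀ r, S ≤ r → r ≤ E → ∃ d, d ≠ c ∧ F d r = F c r := by
    rintro c (rfl | rfl) r h1 h2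
    · exact ⟨b, hab.symm, (heq r h1 h2).symm⟩
    · exact ⟨a, hab, heq r h1 h2⟩
  have hfa : ∀ c, c = a ∨ c = b → ∀ r, S ≤ r → r ≤ E → F c r = F a r := by
    rintro c (rfl | rfl) r h1 h2
    · rfl
    · exact (heq r h1 h2).symm
  -- One of the two loops comes down into the common run, and one of them leaves it downwards.
  obtain ⟨c, hcab, hcS⟩ : ∃ c, (c = a ∨ c = b) ∧ F c (S - 1) = F c S + 1 := by
    by_contra! h
    have h1 := h a (Or.inl rfl)
    have h2 := h b (Or.inr rfl)
    have h3 := (hF a).step (S - 1)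
    have h4 := (hF b).step (S - 1)
    have h5 := heq S le_rfl (by omega)
    apply hS
    simp only [R]
    rw [sub_add_cancel] at h3 h4 ⊢
    omega
  obtain ⟨d, hdab, hdE⟩ : ∃ d, (d = a ∨ d = b) ∧ F d E = F d (E + 1) + 1 := by
    by_contra! h
    have h1 := h a (Or.inl rfl)
    have h2 := h b (Or.inr rfl)
    have h3 := (hF a).step E
    have h4 := (hF b).step E
    have h5 := heq E (by omega) le_rfl
    apply hE
    simp only [R]
    omega
  have hsum : 2 * (E - S) ≤ ∑ r ∈ Ico S E, (2 * (#{x | F x r ≤ F a r} : ℤ) - 1 - k) +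
      ∑ r ∈ Ico S E, (2 * (#{x | F a (r + 1) ≤ F x (r + 1)} : ℤ) - 1 - k) := by
    rw [← sum_add_distrib]
    calc 2 * (E - S) = ∑ r ∈ Ico S E, 2 := by
          rw [sum_const, Int.card_Ico, nsmul_eq_mul, Int.toNat_of_nonneg (by omega), mul_comm]
      _ ≤ _ := by
          refine sum_le_sum fun r hr => ?_
          rw [mem_Ico] at hr
          obtain ⟨h1, h2, h3⟩ := hR r hr.1 hr.2
          have := add_two_le_card_add_card hF hab h1 h2 h3
          omega
  have hcardle : ∀ (p : Fin k → Prop) [DecidablePred p], (#{x | p x} : ℤ) ≤ k := by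
    intro p _
    have := card_filter_le (univ : Finset (Fin k)) p
    rw [card_univ, Fintype.card_fin] at this
    exact_mod_cast this
  have e1 : ∀ A B, S ≤ A → B ≤ E → ∀ x, (x = a ∨ x = b) →
      ∑ r ∈ Ico A B, (2 * (#{y | F y r ≤ F x r} : ℤ) - 1 - k) =
        ∑ r ∈ Ico A B, (2 * (#{y | F y r ≤ F a r} : ℤ) - 1 - k) := by
    intro A B h1 h2 x hx
    refine sum_congr rfl fun r hr => ?_
    rw [mem_Ico] at hr
    rw [hfa x hx r (by omega) (by omega)]
  have e2 : ∀ A B, S ≤ A → B ≤ E → ∀ x, (x = a ∨ x = b) →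
      ∑ r ∈ Ico (A + 1) (B + 1), (2 * (#{y | F x r ≤ F y r} : ℤ) - 1 - k) =
        ∑ r ∈ Ico A B, (2 * (#{y | F a (r + 1) ≤ F y (r + 1)} : ℤ) - 1 - k) := by
    intro A B h1 h2 x hx
    rw [← Finset.map_add_right_Ico, sum_map]
    simp only [addRightEmbedding_apply]
    refine sum_congr rfl fun r hr => ?_
    rw [mem_Ico] at hr
    rw [hfa x hx (r + 1) (by omega) (by omega)]
  have hn0 : 0 < n := by omega
  rcases hlen.lt_or_eq with hlt | hE
  · have h1 := sum_push_le_zero hn0 hF hc hmax (c := c) (A := S) (B := E) (by omega) (by omega) hcS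
      (by have := hup c hcab (E - 1) (by omega) (by omega); rwa [sub_add_cancel] at this)
      (fun r h1 h2 => hother c hcab r h1 h2.le)
    have h2 := sum_push_down_le_zero hn0 hF hc hmax (c := d) (A := S + 1) (B := E + 1) (by omega)
      (by omega) (by rw [add_sub_cancel_right]; exact hup d hdab S le_rfl (by omega))
      (by rw [add_sub_cancel_right]; exact hdE)
      (fun r h1 h2 => hother d hdab r (by omega) (by omega))
    rw [e1 S E le_rfl le_rfl c hcab] at h1
    rw [e2 S E le_rfl le_rfl d hdab] at h2
    omega
  · -- Both ends of a run of length `n` are the same point of the Möbius strip, at height `0` and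
    -- `n`, so each push has to leave out the last point it reaches. The two terms lost
    -- are at most `k - 1` each, which `k ≤ n` makes affordable.
    have h1 := sum_push_le_zero hn0 hF hc hmax (c := c) (A := S) (B := E - 1) (by omega) (by omega)
      hcS
      (by
        have := hup c hcab (E - 1 - 1) (by omega) (by omega)
        rwa [sub_add_cancel] at this)
      (fun r h1 h2 => hother c hcab r h1 (by omega))
    have h2 := sum_push_down_le_zero hn0 hF hc hmax (c := d) (A := S + 1 + 1) (B := E + 1)
      (by omega) (by omega)
      (by rw [add_sub_cancel_right]; exact hup d hdab (S + 1) (by omega) (by omega))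
      (by rw [add_sub_cancel_right]; exact hdE)
      (fun r h1 h2 => hother d hdab r (by omega) (by omega))
    rw [e1 S (E - 1) le_rfl (by omega) c hcab] at h1
    rw [e2 (S + 1) E (by omega) le_rfl d hdab] at h2
    rw [sum_Ico_append _ (show S ≤ E - 1 by omega) (show E - 1 ≤ E by omega),
      sum_Ico_append (fun r => 2 * (#{x | F a (r + 1) ≤ F x (r + 1)} : ℤ) - 1 - k)
      (show S ≤ S + 1 by omega) (show S + 1 ≤ E by omega)] at hsum
    have i1 : Ico (E - 1) E = {E - 1} := by ext x; simp only [mem_Ico, mem_singleton]; omega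
    have i2 : Ico S (S + 1) = {S} := by ext x; simp only [mem_Ico, mem_singleton]; omega
    rw [i1, i2, sum_singleton, sum_singleton] at hsum
    have h3 := hcardle (fun x => F x (E - 1) ≤ F a (E - 1))
    have h4 := hcardle (fun x => F a (S + 1) ≤ F x (S + 1))
    omega

theorem exists_edgeDisjoint {F₀ : Fin k → ℤ → ℤ} (hn : 2 ≤ n) (hkn : (k : ℤ) ≤ n)
    (hF₀ : ∀ a, IsLoop n (F₀ a)) (hc₀ : Covers n F₀) :
    ∃ F : Fin k → ℤ → ℤ, (∀ a, IsLoop n (F a)) ∧ Covers n F ∧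
      ∀ a b t, a ≠ b → F a t = F b t → F a (t + 1) ≠ F b (t + 1) := by
  obtain ⟨F, hF, hc, hmax⟩ := exists_max_spread (by omega) hF₀ hc₀
  refine ⟨F, hF, hc, fun a b t hab h h' => ?_⟩
  rcases (hF a).step t with h1 | h1
  · exact not_common_up_step hn hkn hF hc hmax hab t ⟨h, h1, by omega⟩
  · refine not_common_up_step hn hkn hF hc hmax hab (t + n) ?_
    rw [show t + n + 1 = t + 1 + n by ring]
    simp only [(hF _).anti]
    omega

end LoopFamily

/-! ### Counting meeting points of loops -/

namespace LoopFamily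

/-- Twice the number of chords, counted by the points that represent them in one period. -/
theorem card_pairs_parity (n : ℕ) :
    2 * #{p ∈ Ico (0 : ℤ) n ×ˢ Ico (1 : ℤ) n | (2 : ℤ) ∣ p.2 - p.1} = n * (n - 1) := by
  have h1 := card_filter_add_card_filter_not (s := Ico (0 : ℤ) n ×ˢ Ico (1 : ℤ) n)
    (fun p => (2 : ℤ) ∣ p.2 - p.1)
  have h2 : #{p ∈ Ico (0 : ℤ) n ×ˢ Ico (1 : ℤ) n | ¬ (2 : ℤ) ∣ p.2 - p.1} =
      #{p ∈ Ico (0 : ℤ) n ×ˢ Ico (1 : ℤ) n | (2 : ℤ) ∣ p.2 - p.1} := by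
    -- One of the reflections of the two factors changes the parity of the difference.
    rcases Nat.even_or_odd' n with ⟨m, hm | hm⟩
    · refine card_nbij' (fun p => (n - 1 - p.1, p.2)) (fun p => (n - 1 - p.1, p.2)) ?_ ?_ ?_ ?_ <;>
      rintro ⟨t, x⟩ h <;>
      simp only [mem_coe, mem_filter, mem_product, mem_Ico, Prod.mk.injEq] at h ⊢ <;>
      and_intros <;> first | trivial | omega
    · refine card_nbij' (fun p => (p.1, n - p.2)) (fun p => (p.1, n - p.2)) ?_ ?_ ?_ ?_ <;>
      rintro ⟨t, x⟩ h <;>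
      simp only [mem_coe, mem_filter, mem_product, mem_Ico, Prod.mk.injEq] at h ⊢ <;>
      and_intros <;> first | trivial | omega
  rw [h2, card_product, Int.card_Ico, Int.card_Ico] at h1
  rw [two_mul, h1]
  congr 1; omega

/-- Without common steps a point lies on at most two loops. Each of the `k.choose 2` pairs of loops
then has a meeting point of its own, while `n * k` counts each point with the number of loops
through it, so `n.choose 2 + k.choose 2 ≤ n * k`. -/
theorem choose_two_bound_of_edgeDisjoint {n k : ℕ} {F : Fin k → ℤ → ℤ} (hn : 0 < n)
    (hF : ∀ a, IsLoop n (F a)) (hc : Covers n F)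
    (hdisj : ∀ a b t, a ≠ b → F a t = F b t → F a (t + 1) ≠ F b (t + 1)) :
    n * (n - 1) + k * (k - 1) ≤ 2 * (n * k) := by
  classical
  -- Three loops through a point would enter it by two steps.
  have htwo : ∀ t a b c, F a t = F c t → F b t = F c t → a ≠ c → b ≠ c → a = b := by
    intro t a b c hac hbc ha hb
    by_contra hab
    have h1 := (hF a).step (t - 1)
    have h2 := (hF b).step (t - 1)
    have h3 := (hF c).step (t - 1)
    have h4 := hdisj a b (t - 1) hab
    have h5 := hdisj a c (t - 1) ha
    have h6 := hdisj b c (t - 1) hb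
    rw [sub_add_cancel] at *
    omega
  have hmeet : ∀ b : Fin k, (b : ℕ) ≤ #{t ∈ Ico (0 : ℤ) n | ∃ a < b, F a t = F b t} := by
    intro b
    have hex : ∀ a, ∃ t, 0 ≤ t ∧ t < (n : ℤ) ∧ F a t = F b t := fun a =>
      (hF a).exists_eq (hF b) (by omega)
    choose τ h0 h1 h2 using hex
    rw [← Fin.card_Iio b]
    refine card_le_card_of_injOn τ ?_ ?_
    · intro a ha
      simp only [coe_Iio, Set.mem_Iio] at ha
      rw [mem_coe, mem_filter, mem_Ico]
      exact ⟨⟨h0 a, h1 a⟩, a, ha, h2 a⟩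
    · intro a ha a' ha' h
      simp only [coe_Iio, Set.mem_Iio] at ha ha'
      exact htwo (τ a) a a' b (h2 a) (by rw [h]; exact h2 a') ha.ne ha'.ne
  have hcov : #{p ∈ Ico (0 : ℤ) n ×ˢ Ico (1 : ℤ) n | (2 : ℤ) ∣ p.2 - p.1} ≤
      ∑ b : Fin k, #{t ∈ Ico (0 : ℤ) n | ¬ ∃ a < b, F a t = F b t} := by
    rw [← card_sigma]
    refine (card_le_card ?_).trans (card_image_le (f := fun p : (_ : Fin k) × ℤ => (p.2, F p.1 p.2)))
    rintro ⟨t, x⟩ hp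
    simp only [mem_filter, mem_product, mem_Ico] at hp
    obtain ⟨a, ha⟩ := hc t x (by omega) (by omega) hp.2
    -- Count a covered point at the least index of a loop through it.
    obtain ⟨m, hm, hmin⟩ : ∃ m, F m t = x ∧ ∀ c < m, F c t ≠ x := by
      have hne : ({a | F a t = x} : Finset (Fin k)).Nonempty := ⟨a, by simpa using ha⟩
      refine ⟨_, by simpa using min'_mem _ hne, fun c hlt hct => ?_⟩
      exact absurd (min'_le _ c (by simpa using hct)) (not_le.2 hlt)
    refine mem_image.2 ⟨⟨m, t⟩, mem_sigma.2 ⟨mem_univ m, ?_⟩, by rw [hm]⟩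
    simp only [mem_filter, mem_Ico]
    refine ⟨hp.1.1, ?_⟩
    rintro ⟨c, hlt, hct⟩
    exact hmin c hlt (hct.trans hm)
  have hsplit : ∀ b : Fin k, #{t ∈ Ico (0 : ℤ) n | ∃ a < b, F a t = F b t} +
      #{t ∈ Ico (0 : ℤ) n | ¬ ∃ a < b, F a t = F b t} = n := by
    intro b
    rw [card_filter_add_card_filter_not]
    simp
  have hk : (∑ b : Fin k, (b : ℕ)) * 2 = k * (k - 1) := by
    rw [Fin.sum_univ_eq_sum_range (fun i => i) k, sum_range_id_mul_two]
  have h1 := sum_le_sum fun b (_ : b ∈ (univ : Finset (Fin k))) => hmeet b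
  have h2 := card_pairs_parity n
  have h3 := sum_congr rfl fun b (_ : b ∈ (univ : Finset (Fin k))) => hsplit b
  rw [sum_add_distrib, sum_const, card_univ, Fintype.card_fin, smul_eq_mul, mul_comm k n] at h3
  omega

end LoopFamily

/-- The bound for colourings. The vertices are indexed periodically by `ℤ`; chords with disjoint
nested index intervals, that is disjoint chords, get different colours. Hence the chords of one
colour are pairwise comparable and lie on a common loop. -/
theorem choose_two_bound_of_colouring {n k : ℕ} (hn : 2 ≤ n) (hkn : k ≤ n) (col : ℤ → ℤ → Fin k)
    (hcol : ∀ i j : ℤ, col j (i + n) = col i j)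
    (hne : ∀ i i' j' j : ℤ, i < i' → i' < j' → j' < j → j < i + n → col i j ≠ col i' j') :
    n * (n - 1) + k * (k - 1) ≤ 2 * (n * k) := by
  have hn' : (0 : ℤ) < n := by omega
  have hloop : ∀ a : Fin k, ∃ f, IsLoop n f ∧
      ∀ i j : ℤ, i < j → j < i + n → col i j = a → f (i + j) = j - i := by
    intro a
    obtain ⟨f, hf, hfT⟩ := exists_isLoop_through hn'
      {p | ∃ i j : ℤ, i < j ∧ j < i + n ∧ col i j = a ∧ p = (i + j, j - i)}
      (by rintro _ ⟨i, j, -, -, -, rfl⟩; exact ⟨-i, by ring⟩)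
      (by
        rintro _ ⟨i, j, h1, h2, h3, rfl⟩
        exact ⟨j, i + n, h2, by omega, by rw [hcol, h3], by ext <;> simp only <;> ring⟩)
      (by
        rintro _ ⟨i, j, h1, h2, h3, rfl⟩
        refine ⟨j - n, i, by omega, by omega, ?_, by ext <;> simp only <;> ring⟩
        rw [← hcol, sub_add_cancel, h3])
      (by
        rintro _ ⟨i, j, h1, h2, h3, rfl⟩ _ ⟨i', j', h1', h2', h3', rfl⟩
        by_contra hlt
        simp only at hlt
        have : (i < i' ∧ j' < j) ∨ (i' < i ∧ j < j') := by
          by_contra hcon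
          apply hlt
          rw [abs_le]
          rcases abs_cases (i + j - (i' + j')) with h | h <;> omega
        rcases this with h | h
        · exact hne i i' j' j h.1 h1' h.2 h2 (h3.trans h3'.symm)
        · exact hne i' i j j' h.1 h1 h.2 h2' (h3'.trans h3.symm))
    exact ⟨f, hf, fun i j h1 h2 h3 => hfT _ ⟨i, j, h1, h2, h3, rfl⟩⟩
  choose F₀ hF₀ hF₀' using hloop
  obtain ⟨F, hF, hc, hdisj⟩ := LoopFamily.exists_edgeDisjoint (by omega) (by omega) hF₀ (by
    rintro t x h1 h2 ⟨w, hw⟩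
    refine ⟨col (-w) (x - w), ?_⟩
    have h := hF₀' _ (t - (t + w)) (x - w) (by omega) (by omega) rfl
    rw [show t - (t + w) = -w by ring] at h
    convert h using 1
    · congr 1; omega
    · ring)
  exact LoopFamily.choose_two_bound_of_edgeDisjoint (by omega) hF hc hdisj

/-! ### A colouring with classes of pairwise meeting chords -/

namespace TriangularColouring

/-- The triangular number `0 + 1 + ⋯ + s`. -/
def tri (s : ℕ) : ℕ := (s + 1).choose 2

theorem tri_succ (s : ℕ) : tri (s + 1) = tri s + s + 1 := by
  rw [tri, tri, Nat.choose_succ_succ' (s + 1) 1, Nat.choose_one_right]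
  ring

theorem tri_strictMono : StrictMono tri :=
  strictMono_nat_of_lt_succ fun s => by rw [tri_succ]; omega

theorem two_mul_tri (s : ℕ) : 2 * tri s = s * (s + 1) := by
  induction s with
  | zero => rfl
  | succ s ih => rw [tri_succ]; linarith

theorem exists_tri_le_lt (y : ℕ) : ∃ s, tri s ≤ y ∧ y < tri (s + 1) := by
  induction y with
  | zero => exact ⟨0, le_rfl, by decide⟩
  | succ y ih =>
    obtain ⟨s, h1, h2⟩ := ih
    rcases Nat.lt_or_ge (y + 1) (tri (s + 1)) with h | h
    · exact ⟨s, by omega, h⟩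
    · exact ⟨s + 1, h, by rw [tri_succ (s + 1)]; omega⟩

theorem eq_of_tri_le_lt {y s s' : ℕ} (h1 : tri s ≤ y) (h2 : y < tri (s + 1)) (h1' : tri s' ≤ y)
    (h2' : y < tri (s' + 1)) : s = s' := by
  have h3 := tri_strictMono.lt_iff_lt.1 (h1.trans_lt h2')
  have h4 := tri_strictMono.lt_iff_lt.1 (h1'.trans_lt h2)
  omega

/-- The vertices `0, 1, 2, …` are split into consecutive groups of sizes `1, 2, 3, …`; the group
with `s + 1` elements starts at `tri s`. This says that `a` is the last element of its group. -/
def IsLast (a : ℕ) : Prop := ∃ c, a + 1 = tri (c + 1)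

theorem not_isLast_of_lt {s e : ℕ} (he : e < s) : ¬ IsLast (tri s + e) := by
  rintro ⟨c, hc⟩
  have h1 : tri s < tri (c + 1) := by omega
  have h2 : tri (c + 1) < tri (s + 1) := by rw [tri_succ s]; omega
  have h3 := tri_strictMono.lt_iff_lt.1 h1
  have h4 := tri_strictMono.lt_iff_lt.1 h2
  omega

/-- `HasColour x y a`: the chord with ends `x < y` may be given the colour `a`. The colours are the
vertices that are not last in their group. The class of the colour `a = tri s + e` with `e < s` is
part of a triangle with pendant edges: with `z = tri (s - e) - 1`, the last element of an earlier
group, that graph joins `a` to everything outside `[z, a]` and to `z`, and `a + 1` to everything in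
`[z, a]`. A chord is listed under `right` or `pred` only if its smaller end is last in its group, all
others being coloured by their smaller end. -/
inductive HasColour : ℕ → ℕ → ℕ → Prop
  | left {x y : ℕ} (hx : ¬ IsLast x) : HasColour x y x
  | right {c s e y : ℕ} (hy : y = tri s + e) (h : c + 1 + e ≤ s) :
      HasColour (tri (c + 1) - 1) y y
  | pred {c s e y : ℕ} (hy : y = tri s + e) (hes : e < s) (h : s < c + 1 + (e + 1)) :
      HasColour (tri (c + 1) - 1) (y + 1) y

theorem exists_hasColour {x y : ℕ} (hxy : x < y) :
    ∃ a, a ≤ y ∧ ¬ IsLast a ∧ HasColour x y a := by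
  by_cases hx : IsLast x
  · obtain ⟨c, hc⟩ := hx
    obtain ⟨s, h1, h2⟩ := exists_tri_le_lt y
    have hcs : c < s := by
      have := tri_strictMono.lt_iff_lt.1 (show tri (c + 1) < tri (s + 1) by omega)
      omega
    obtain rfl : x = tri (c + 1) - 1 := by omega
    obtain ⟨e, rfl⟩ := Nat.exists_eq_add_of_le h1
    rw [tri_succ] at h2
    rcases Nat.lt_or_ge s (c + 1 + e) with h | h
    · obtain ⟨e, rfl⟩ : ∃ e', e = e' + 1 := ⟨e - 1, by omega⟩
      exact ⟨tri s + e, by omega, not_isLast_of_lt (by omega), .pred rfl (by omega) h⟩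
    · exact ⟨_, le_rfl, not_isLast_of_lt (by omega), .right rfl h⟩
  · exact ⟨x, hxy.le, hx, .left hx⟩

/-- The chords with ends `x < y` and `x' < y'` share an end or cross. -/
def Meet (x y x' y' : ℕ) : Prop :=
  x = x' ∨ x = y' ∨ y = x' ∨ y = y' ∨ (x < x' ∧ x' < y ∧ y < y') ∨ (x' < x ∧ x < y' ∧ y' < y)

/-- Chords of the same colour meet. The case that is not immediate is a chord from `z` or below to
`a` against one from `a + 1` to `z` or above (`hgt`). -/
theorem HasColour.meet {x y x' y' a : ℕ} (hxy : x < y) (hxy' : x' < y') (ha : ¬ IsLast a)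
    (h : HasColour x y a) (h' : HasColour x' y' a) : Meet x y x' y' := by
  have hne : ∀ c, tri (c + 1) - 1 ≠ a := by
    rintro c rfl
    exact ha ⟨c, by rw [tri_succ]; omega⟩
  have hgt : ∀ c c' s s' e e', a = tri s + e → a = tri s' + e' → c + 1 + e ≤ s → e' < s' →
      s' < c' + 1 + (e' + 1) → tri (c + 1) ≤ tri (c' + 1) := by
    intro c c' s s' e e' h1 h1' h2 h2' h3
    obtain rfl : s = s' := eq_of_tri_le_lt (y := a) (by omega) (by rw [tri_succ]; omega) (by omega)
      (by rw [tri_succ]; omega)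
    exact tri_strictMono.monotone (by omega)
  unfold Meet
  cases h with
  | left _ =>
    cases h' with
    | left _ => omega
    | right _ _ => omega
    | @pred c' => have := hne c'; omega
  | @right c s e _ hy hs =>
    cases h' with
    | left _ => omega
    | right _ _ => omega
    | @pred c' s' e' _ hy' hes' hs' =>
      have h1 := hgt c c' s s' e e' hy hy' hs hes' hs'
      have := hne c'
      omega
  | @pred c s e _ hy hes hs =>
    cases h' with
    | left _ => have := hne c; omega
    | @right c' s' e' _ hy' hs' =>
      have h1 := hgt c' c s' s e' e hy' hy hs' hes hs
      have := hne c
      omega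
    | pred _ _ _ => omega

open Classical in
theorem card_not_isLast {n m : ℕ} (h1 : tri m ≤ n) (h2 : n < tri (m + 1)) :
    #{a ∈ range n | ¬ IsLast a} = n - m := by
  have h : #{a ∈ range n | IsLast a} = m := by
    have : ({a ∈ range n | IsLast a} : Finset ℕ) = (range m).image fun c => tri (c + 1) - 1 := by
      ext a
      simp only [mem_filter, mem_range, mem_image]
      unfold IsLast
      constructor
      · rintro ⟨ha, c, hc⟩
        have := tri_strictMono.lt_iff_lt.1 (show tri (c + 1) < tri (m + 1) by omega)
        exact ⟨c, by omega, by omega⟩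
      · rintro ⟨c, hc, rfl⟩
        have h3 := tri_strictMono.monotone (show c + 1 ≤ m by omega)
        have h4 := tri_succ c
        exact ⟨by omega, c, by omega⟩
    rw [this, card_image_of_injective, card_range]
    intro c c' hcc
    have h3 := tri_succ c
    have h4 := tri_succ c'
    have := tri_strictMono.injective (show tri (c + 1) = tri (c' + 1) by simp only at hcc; omega)
    omega
  have := card_filter_add_card_filter_not (s := range n) IsLast
  rw [h, card_range] at this
  omega

end TriangularColouring

/-! ### Points in strictly convex position -/

namespace Plane

/-- Twice the signed area of the triangle `a b c`, positive if it is traversed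
counterclockwise. -/
def cross (a b c : Plane) : ℝ := (b 0 - a 0) * (c 1 - a 1) - (b 1 - a 1) * (c 0 - a 0)

theorem cross_rotate (a b c : Plane) : cross b c a = cross a b c := by
  unfold cross; ring

theorem ext_coord {p q : Plane} (h0 : p 0 = q 0) (h1 : p 1 = q 1) : p = q := by
  ext i
  fin_cases i
  exacts [h0, h1]

theorem disjoint_segment {a b c d : Plane} (hc : 0 < cross a b c) (hd : 0 < cross a b d) :
    Disjoint (segment ℝ a b) (segment ℝ c d) := by
  rw [Set.disjoint_left]
  rintro _ ⟨s, t, -, -, hst, rfl⟩ ⟨u, v, hu, hv, huv, h⟩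
  have h0 := congrArg (fun p : Plane => p 0) h
  have h1 := congrArg (fun p : Plane => p 1) h
  simp only [PiLp.add_apply, PiLp.smul_apply, smul_eq_mul] at h0 h1
  have key : u * cross a b c + v * cross a b d = 0 := by
    obtain rfl : s = 1 - t := by linarith
    obtain rfl : u = 1 - v := by linarith
    unfold cross
    linear_combination (b 0 - a 0) * h1 - (b 1 - a 1) * h0
  rcases hu.eq_or_lt with rfl | hu'
  · obtain rfl : v = 1 := by linarith
    linarith
  · have := mul_pos hu' hc
    have := mul_nonneg hv hd.le
    linarith

/-- The diagonals of the counterclockwise convex quadrilateral `a c b d` meet. -/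
theorem not_disjoint_segment {a b c d : Plane} (h1 : 0 < cross a c b) (h2 : 0 < cross a b d)
    (h3 : 0 < cross a c d) (h4 : 0 < cross c b d) :
    ¬ Disjoint (segment ℝ a b) (segment ℝ c d) := by
  rw [Set.not_disjoint_iff]
  have hs : cross a c b + cross a b d = cross a c d + cross c b d := by unfold cross; ring
  set w := cross a c b + cross a b d with hw
  have hw0 : 0 < w := by positivity
  refine ⟨(cross c b d / w) • a + (cross a c d / w) • b, ⟨_, _, by positivity, by positivity, ?_, rfl⟩,
    ⟨cross a b d / w, cross a c b / w, by positivity, by positivity, ?_, ?_⟩⟩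
  · rw [← add_div, add_comm, ← hs, div_self hw0.ne']
  · rw [← add_div, add_comm, ← hw, div_self hw0.ne']
  · apply ext_coord <;> simp only [PiLp.add_apply, PiLp.smul_apply, smul_eq_mul] <;>
    field_simp <;> unfold cross <;> ring

/-- For `a` to the right of `p`, or above it, an increasing function of the angle at which `a` is
seen from `p`. Unlike the quotient of the coordinate differences it is meaningful in the vertical
direction. -/
noncomputable def slope (p a : Plane) : ℝ := (a 1 - p 1) / (a 0 - p 0 + |a 1 - p 1|)

theorem add_abs_pos {x y : ℝ} (hx : 0 ≤ x) (hy : x = 0 → 0 < y) : 0 < x + |y| := by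
  rcases hx.eq_or_lt with h | h
  · have := abs_pos_of_pos (hy h.symm); linarith
  · have := abs_nonneg y; linarith

theorem cross_pos_of_slope_lt {p a b : Plane} (ha : 0 ≤ a 0 - p 0) (hb : 0 ≤ b 0 - p 0)
    (ha' : a 0 - p 0 = 0 → 0 < a 1 - p 1) (hb' : b 0 - p 0 = 0 → 0 < b 1 - p 1)
    (h : slope p a < slope p b) : 0 < cross p a b := by
  unfold slope at h
  unfold cross
  generalize a 0 - p 0 = x at *
  generalize a 1 - p 1 = y at *
  generalize b 0 - p 0 = x' at *
  generalize b 1 - p 1 = y' at *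
  rw [div_lt_div_iff₀ (add_abs_pos ha ha') (add_abs_pos hb hb')] at h
  rcases le_or_gt 0 y with hy | hy <;> rcases le_or_gt 0 y' with hy' | hy'
  · rw [abs_of_nonneg hy, abs_of_nonneg hy'] at h; linarith
  · have := mul_nonneg hy (add_abs_pos hb hb').le
    have := mul_neg_of_neg_of_pos hy' (add_abs_pos ha ha')
    linarith
  · have hx : 0 < x := ha.lt_of_ne fun h0 => by have := ha' h0.symm; linarith
    have := mul_nonneg hx.le hy'
    rcases hb.eq_or_lt with h0 | h0
    · have := mul_pos hx (hb' h0.symm)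
      rw [← h0]; linarith
    · have := mul_neg_of_neg_of_pos hy h0
      linarith
  · rw [abs_of_neg hy, abs_of_neg hy'] at h; linarith

theorem mem_segment_of_slope_eq {p a b : Plane} (ha : 0 ≤ a 0 - p 0) (hb : 0 ≤ b 0 - p 0)
    (ha' : a 0 - p 0 = 0 → 0 < a 1 - p 1) (hb' : b 0 - p 0 = 0 → 0 < b 1 - p 1)
    (h : slope p a = slope p b) : a ∈ segment ℝ p b ∨ b ∈ segment ℝ p a := by
  have key : ∀ {a b : Plane}, 0 ≤ a 0 - p 0 → 0 ≤ b 0 - p 0 →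
      (a 0 - p 0 = 0 → 0 < a 1 - p 1) → (b 0 - p 0 = 0 → 0 < b 1 - p 1) →
      slope p a = slope p b → a 0 - p 0 + |a 1 - p 1| ≤ b 0 - p 0 + |b 1 - p 1| →
      a ∈ segment ℝ p b := by
    intro a b ha hb ha' hb' h hle
    have pa := add_abs_pos ha ha'
    have pb := add_abs_pos hb hb'
    unfold slope at h
    set s := a 0 - p 0 + |a 1 - p 1| with hs
    set s' := b 0 - p 0 + |b 1 - p 1| with hs'
    have h1 : (a 1 - p 1) * s' = (b 1 - p 1) * s := by
      rwa [div_eq_div_iff pa.ne' pb.ne'] at h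
    have h2 : |a 1 - p 1| * s' = |b 1 - p 1| * s := by
      have := congrArg abs h1
      rwa [abs_mul, abs_mul, abs_of_pos pa, abs_of_pos pb] at this
    have h0 : (a 0 - p 0) * s' = (b 0 - p 0) * s := by
      have e1 : a 0 - p 0 = s - |a 1 - p 1| := by rw [hs]; ring
      have e2 : b 0 - p 0 = s' - |b 1 - p 1| := by rw [hs']; ring
      rw [e1, e2]
      linear_combination -h2
    refine ⟨1 - s / s', s / s', ?_, by positivity, by ring, ?_⟩
    · rw [sub_nonneg, div_le_one pb]; exact hle
    · apply ext_coord <;> simp only [PiLp.add_apply, PiLp.smul_apply, smul_eq_mul] <;> field_simp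
      · linear_combination -h0
      · linear_combination -h1
  rcases le_total (a 0 - p 0 + |a 1 - p 1|) (b 0 - p 0 + |b 1 - p 1|) with hle | hle
  · exact Or.inl (key ha hb ha' hb' h hle)
  · exact Or.inr (key hb ha hb' ha' h.symm hle)

end Plane

open Plane

namespace StrictlyConvexPosition

variable {P : Finset Plane}

theorem notMem_segment (hP : StrictlyConvexPosition P) {a b c : Plane} (ha : a ∈ P) (hb : b ∈ P)
    (hc : c ∈ P) (hab : a ≠ b) (hac : a ≠ c) : a ∉ segment ℝ b c := by
  intro h
  refine hP a ha (segment_subset_convexHull ?_ ?_ h)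
  exacts [⟨hb, hab.symm⟩, ⟨hc, hac.symm⟩]

/-- If `a`, `b`, `c` are seen from `p` in counterclockwise order and `a b c` were not
counterclockwise, then `b` would lie in the triangle `p a c`. -/
theorem cross_pos_of_fan (hP : StrictlyConvexPosition P) {p a b c : Plane} (hp : p ∈ P)
    (ha : a ∈ P) (hb : b ∈ P) (hc : c ∈ P) (hab : 0 < cross p a b) (hbc : 0 < cross p b c)
    (hac : 0 < cross p a c) : 0 < cross a b c := by
  by_contra! hneg
  have hpb : p ≠ b := by rintro rfl; simp [cross] at hbc
  have hne : a ≠ b := by rintro rfl; simp [cross, mul_comm] at hab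
  have hne' : c ≠ b := by rintro rfl; simp [cross, mul_comm] at hbc
  refine hP b hb ?_
  have hsub : ∀ q ∈ P, q ≠ b → q ∈ convexHull ℝ ((P : Set Plane) \ {b}) := fun q hq hqb =>
    subset_convexHull ℝ _ ⟨hq, hqb⟩
  set w := cross p a c with hw
  have h := (convex_convexHull ℝ ((P : Set Plane) \ {b})).sum_mem (t := univ)
    (w := ![-cross a b c / w, cross p b c / w, cross p a b / w]) (z := ![p, a, c])
    (by
      intro i _
      have : 0 ≤ -cross a b c := by linarith
      fin_cases i <;> simp <;> positivity)
    (by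
      rw [Fin.sum_univ_three]
      simp
      rw [← add_div, ← add_div, div_eq_one_iff_eq hac.ne', hw]
      unfold cross; ring)
    (by
      intro i _
      fin_cases i
      exacts [hsub p hp hpb, hsub a ha hne, hsub c hc hne'])
  convert h using 1
  rw [Fin.sum_univ_three]
  apply ext_coord <;> simp [-neg_add_rev] <;> field_simp <;> rw [hw] <;> unfold cross <;> ring

/-- The points can be listed in counterclockwise order: start at the lexicographically least one
and sort the others by the angle at which it sees them. -/
theorem exists_enumeration (hP : StrictlyConvexPosition P) :
    ∃ p : ℕ → Plane, (∀ i < #P, p i ∈ P) ∧ (∀ q ∈ P, ∃ i < #P, p i = q) ∧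
      (∀ i j, i < j → j < #P → p i ≠ p j) ∧
      ∀ i j l, i < j → j < l → l < #P → 0 < cross (p i) (p j) (p l) := by
  classical
  rcases P.eq_empty_or_nonempty with rfl | hne
  · exact ⟨fun _ => 0, by simp, by simp, by simp, by simp⟩
  obtain ⟨o, ho, hmin⟩ := P.exists_min_image (fun q => toLex (q 0, q 1)) hne
  have hx : ∀ a ∈ P, 0 ≤ a 0 - o 0 := by
    intro a ha
    rcases Prod.Lex.toLex_le_toLex.1 (hmin a ha) with h | h
    · simp only at h; linarith
    · simp only at h; linarith [h.1]
  have hy : ∀ a ∈ P, a ≠ o → a 0 - o 0 = 0 → 0 < a 1 - o 1 := by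
    intro a ha hao h0
    rcases Prod.Lex.toLex_le_toLex.1 (hmin a ha) with h | h
    · simp only at h; linarith
    · simp only at h
      rcases h.2.eq_or_lt with h1 | h1
      · exact absurd (ext_coord (by linarith) h1.symm) hao
      · linarith
  have hinj : Set.InjOn (slope o) (P.erase o) := by
    intro a ha b hb h
    rw [mem_coe, mem_erase] at ha hb
    by_contra hab
    rcases mem_segment_of_slope_eq (hx a ha.2) (hx b hb.2) (hy a ha.2 ha.1) (hy b hb.2 hb.1) h
      with h | h
    · exact hP.notMem_segment ha.2 ho hb.2 ha.1 hab h
    · exact hP.notMem_segment hb.2 ho ha.2 hb.1 (Ne.symm hab) h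
  have hcard : #((P.erase o).image (slope o)) = #P - 1 := by
    rw [card_image_of_injOn hinj, card_erase_of_mem ho]
  have hP1 : 0 < #P := hne.card_pos
  let e := ((P.erase o).image (slope o)).orderEmbOfFin hcard
  have he : ∀ i, ∃ q, q ∈ P.erase o ∧ slope o q = e i := fun i =>
    mem_image.1 (orderEmbOfFin_mem _ hcard i)
  choose q hq hqe using he
  have hqP : ∀ i, q i ∈ P := fun i => mem_of_mem_erase (hq i)
  have hqo : ∀ i, q i ≠ o := fun i => ne_of_mem_erase (hq i)
  have hlt : ∀ i j, i < j → 0 < cross o (q i) (q j) := fun i j hij =>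
    cross_pos_of_slope_lt (hx _ (hqP i)) (hx _ (hqP j)) (hy _ (hqP i) (hqo i))
      (hy _ (hqP j) (hqo j)) (by rw [hqe, hqe]; exact e.strictMono hij)
  let p : ℕ → Plane := fun i => if h : 0 < i ∧ i - 1 < #P - 1 then q ⟨i - 1, h.2⟩ else o
  have hp0 : p 0 = o := by simp [p]
  have hp1 : ∀ i (h : i < #P - 1), p (i + 1) = q ⟨i, h⟩ := by
    intro i h
    simp [p, h]
  refine ⟨p, ?_, ?_, ?_, ?_⟩
  · rintro (_ | i) hi
    · rwa [hp0]
    · rw [hp1 i (by omega)]; exact hqP _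
  · intro a ha
    by_cases hao : a = o
    · exact ⟨0, hP1, by rw [hp0, hao]⟩
    · have h1 : slope o a ∈ Set.range e := by
        rw [range_orderEmbOfFin]
        exact mem_coe.2 (mem_image_of_mem _ (mem_erase.2 ⟨hao, ha⟩))
      obtain ⟨i, hi⟩ := h1
      refine ⟨i + 1, by omega, ?_⟩
      rw [hp1 i i.2]
      exact hinj (hq i) (mem_erase.2 ⟨hao, ha⟩) ((hqe i).trans hi)
  · rintro (_ | i) (_ | j) hij hj
    · omega
    · rw [hp0, hp1 j (by omega)]; exact (hqo _).symm
    · omega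
    · rw [hp1 i (by omega), hp1 j (by omega)]
      intro h
      have := hlt ⟨i, by omega⟩ ⟨j, by omega⟩ (by simpa using hij)
      rw [h] at this
      simp [cross, mul_comm] at this
  · rintro (_ | i) (_ | j) (_ | l) hij hjl hl
    all_goals try omega
    · rw [hp0, hp1 j (by omega), hp1 l (by omega)]
      exact hlt _ _ (by simpa using hjl)
    · rw [hp1 i (by omega), hp1 j (by omega), hp1 l (by omega)]
      exact hP.cross_pos_of_fan ho (hqP _) (hqP _) (hqP _) (hlt _ _ (by simpa using hij))
        (hlt _ _ (by simpa using hjl)) (hlt _ _ (by simp only [Fin.mk_lt_mk]; omega))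

end StrictlyConvexPosition

/-! ### The chromatic number -/

open TriangularColouring

theorem segmentDisjointnessGraph_colorable {P : Finset Plane} (hP : StrictlyConvexPosition P)
    {m : ℕ} (h1 : tri m ≤ #P) (h2 : #P < tri (m + 1)) :
    (segmentDisjointnessGraph P).Colorable (#P - m) := by
  classical
  obtain ⟨p, -, hsurj, -, hcross⟩ := hP.exists_enumeration
  have hrep : ∀ s : SegmentsOn P, ∃ x y, x < y ∧ y < #P ∧ s.1 = segment ℝ (p x) (p y) := by
    rintro ⟨_, a, ha, b, hb, hab, rfl⟩
    obtain ⟨x, hx, rfl⟩ := hsurj a ha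
    obtain ⟨y, hy, rfl⟩ := hsurj b hb
    rcases lt_trichotomy x y with h | h | h
    · exact ⟨x, y, h, hy, rfl⟩
    · exact absurd (congrArg p h) hab
    · exact ⟨y, x, h, hx, segment_symm ℝ _ _⟩
  choose x y hxy hy hs using hrep
  choose a hay ha hcol using fun s => exists_hasColour (hxy s)
  have hcard : Fintype.card {v // v ∈ ({v ∈ range #P | ¬ IsLast v} : Finset ℕ)} = #P - m := by
    rw [Fintype.card_coe, card_not_isLast h1 h2]
  rw [← hcard]
  have hmem : ∀ s, a s ∈ ({v ∈ range #P | ¬ IsLast v} : Finset ℕ) := fun s =>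
    mem_filter.2 ⟨mem_range.2 ((hay s).trans_lt (hy s)), ha s⟩
  refine (SimpleGraph.Coloring.mk (fun s => ⟨a s, hmem s⟩) ?_).colorable
  intro s t hst h
  have hst : Disjoint s.1 t.1 := hst
  simp only [Subtype.mk.injEq] at h
  rw [hs, hs] at hst
  have hcom := Set.disjoint_left.1 hst
  have hl := left_mem_segment ℝ (p (x s)) (p (y s))
  have hr := right_mem_segment ℝ (p (x s)) (p (y s))
  have hl' := left_mem_segment ℝ (p (x t)) (p (y t))
  have hr' := right_mem_segment ℝ (p (x t)) (p (y t))
  rcases (hcol s).meet (hxy s) (hxy t) (ha s) (h ▸ hcol t) with e | e | e | e | e | e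
  · exact hcom hl (by rw [e]; exact hl')
  · exact hcom hl (by rw [e]; exact hr')
  · exact hcom hr (by rw [e]; exact hl')
  · exact hcom hr (by rw [e]; exact hr')
  · have := hy t
    exact not_disjoint_segment (hcross _ _ _ e.1 e.2.1 (by omega))
      (hcross _ _ _ (hxy s) e.2.2 this) (hcross _ _ _ e.1 (hxy t) this)
      (hcross _ _ _ e.2.1 e.2.2 this) hst
  · have := hy s
    exact not_disjoint_segment (hcross _ _ _ e.1 e.2.1 (by omega))
      (hcross _ _ _ (hxy t) e.2.2 this) (hcross _ _ _ e.1 (hxy s) this)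
      (hcross _ _ _ e.2.1 e.2.2 this) hst.symm

/-- Reduction modulo `n` preserves the cyclic order of three integers within one period. -/
theorem emod_cyclic {n i j l : ℤ} (hij : i < j) (hjl : j < l) (hl : l < i + n) :
    (i % n < j % n ∧ j % n < l % n) ∨ (j % n < l % n ∧ l % n < i % n) ∨
      (l % n < i % n ∧ i % n < j % n) := by
  have hn : 0 < n := by omega
  have h0 := Int.emod_nonneg i hn.ne'
  have h1 := Int.emod_lt_of_pos i hn
  have key : ∀ u, 0 < u → u < n → (i + u) % n = if i % n + u < n then i % n + u
      else i % n + u - n := by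
    intro u hu hun
    rw [← Int.emod_add_emod]
    split_ifs with h
    · exact Int.emod_eq_of_lt (by omega) h
    · rw [← Int.sub_emod_right, Int.emod_eq_of_lt (by omega) (by omega)]
  have hj := key (j - i) (by omega) (by omega)
  have hl := key (l - i) (by omega) (by omega)
  rw [add_sub_cancel] at hj hl
  rw [hj, hl]
  split_ifs <;> omega

theorem le_of_segmentDisjointnessGraph_colorable {P : Finset Plane}
    (hP : StrictlyConvexPosition P) {m k : ℕ} (h2 : #P < tri (m + 1))
    (hk : (segmentDisjointnessGraph P).Colorable k) : #P - m ≤ k := by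
  classical
  by_contra! hlt
  set n := #P with hn
  have hn2 : 2 ≤ n := by
    by_contra! h
    obtain rfl : m = 0 := by omega
    have : tri (0 + 1) = 1 := rfl
    omega
  obtain ⟨p, hmem, -, hne, hcross⟩ := hP.exists_enumeration
  obtain ⟨C⟩ := hk
  let c₀ : Fin k := C ⟨_, p 0, hmem 0 (by omega), p 1, hmem 1 (by omega),
    hne 0 1 one_pos (by omega), rfl⟩
  -- The colour as a function of the segment as a point set, hence symmetric in its ends.
  let colS : Set Plane → Fin k := fun S =>
    if h : ∃ s : SegmentsOn P, s.1 = S then C h.choose else c₀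
  have hcolS : ∀ s : SegmentsOn P, colS s.1 = C s := by
    intro s
    have h : ∃ s' : SegmentsOn P, s'.1 = s.1 := ⟨s, rfl⟩
    simp only [colS, dif_pos h]
    exact congrArg C (Subtype.ext h.choose_spec)
  let q : ℤ → Plane := fun z => p (z % n).toNat
  have hn0 : (0 : ℤ) < n := by omega
  have hlt : ∀ z : ℤ, 0 ≤ z % n ∧ z % n < n := fun z =>
    ⟨Int.emod_nonneg z hn0.ne', Int.emod_lt_of_pos z hn0⟩
  have hqP : ∀ z, q z ∈ P := fun z => hmem _ (by have := hlt z; omega)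
  have hqn : ∀ z, q (z + n) = q z := fun z => by simp only [q, Int.add_emod_right]
  have hqcross : ∀ i j l : ℤ, i < j → j < l → l < i + n → 0 < cross (q i) (q j) (q l) := by
    intro i j l hij hjl hl
    have hi := hlt i
    have hj := hlt j
    have hl' := hlt l
    rcases emod_cyclic hij hjl hl with h | h | h
    · exact hcross _ _ _ (by omega) (by omega) (by omega)
    · rw [← cross_rotate]
      exact hcross _ _ _ (by omega) (by omega) (by omega)
    · rw [← cross_rotate, ← cross_rotate]
      exact hcross _ _ _ (by omega) (by omega) (by omega)
  have hmain := choose_two_bound_of_colouring hn2 (by omega)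
    (fun i j => colS (segment ℝ (q i) (q j)))
    (fun i j => by simp only [hqn, segment_symm ℝ (q j)])
    (by
      intro i i' j' j h1 h2 h3 h4
      have c1 := hqcross i' j' j h2 h3 (by omega)
      have c2 := hqcross i i' j' h1 h2 (by omega)
      have c3 := hqcross i i' j h1 (by omega) h4
      rw [← cross_rotate] at c2
      have hd := disjoint_segment c2 c1
      have hij : q i ≠ q j := by
        intro h; rw [h] at c3; simp [cross, mul_comm] at c3
      have hij' : q i' ≠ q j' := by
        intro h; rw [h] at c1; simp [cross] at c1
      let s : SegmentsOn P := ⟨segment ℝ (q i) (q j), _, hqP i, _, hqP j, hij, rfl⟩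
      let s' : SegmentsOn P := ⟨segment ℝ (q i') (q j'), _, hqP i', _, hqP j', hij', rfl⟩
      have hadj : (segmentDisjointnessGraph P).Adj s s' := hd.symm
      have := C.valid hadj
      rwa [← hcolS s, ← hcolS s'] at this)
  obtain ⟨d, hd⟩ : ∃ d, n = k + (m + 1) + d := ⟨n - (k + (m + 1)), by omega⟩
  have ht := two_mul_tri (m + 1)
  have hk' : k * (k - 1) + k = k * k := by
    rcases k with _ | k
    · rfl
    · rw [Nat.add_sub_cancel]; ring
  have hn' : n * (n - 1) + n = n * n := by
    obtain ⟨n', hn'⟩ : ∃ n', n = n' + 1 := ⟨n - 1, by omega⟩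
    rw [hn', Nat.add_sub_cancel]; ring
  have h3 : n * n + k * k ≤ 2 * (n * k) + n + k := by omega
  rw [hd] at h3 h2
  nlinarith

theorem theorem1 (n : ℕ) (P : Finset Plane) (hcard : P.card = n)
    (hP : StrictlyConvexPosition P) :
    ∃ c : ℕ, (segmentDisjointnessGraph P).chromaticNumber = (c : ℕ∞) ∧
      (c : ℤ) = (n : ℤ) - ⌊Real.sqrt (2 * (n : ℝ) + 1 / 4) - 1 / 2⌋ ∧
      (∃! k : ℕ, (k + 1).choose 2 ≤ n ∧ n < (k + 2).choose 2) ∧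
      (∀ k : ℕ, (k + 1).choose 2 ≤ n → n < (k + 2).choose 2 → (c : ℤ) = (n : ℤ) - (k : ℤ)) := by
  subst hcard
  obtain ⟨m, h1, h2⟩ := exists_tri_le_lt #P
  have hm : m ≤ tri m := tri_strictMono.le_apply
  have huniq : ∀ k : ℕ, (k + 1).choose 2 ≤ #P → #P < (k + 2).choose 2 → k = m :=
    fun k hk hk' => eq_of_tri_le_lt (y := #P) hk hk' h1 h2
  refine ⟨#P - m, ?_, ?_, ⟨m, ⟨h1, h2⟩, fun k hk => huniq k hk.1 hk.2⟩, ?_⟩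
  · refine le_antisymm (segmentDisjointnessGraph_colorable hP h1 h2).chromaticNumber_le ?_
    rw [SimpleGraph.le_chromaticNumber_iff_colorable]
    exact fun k hk => le_of_segmentDisjointnessGraph_colorable hP h2 hk
  · have hfloor : ⌊√(2 * (#P : ℝ) + 1 / 4) - 1 / 2⌋ = (m : ℤ) := by
      have e1 := two_mul_tri m
      have e2 := two_mul_tri (m + 1)
      have l1 : m * (m + 1) ≤ 2 * #P := by omega
      have l2 : 2 * #P < (m + 1) * (m + 1 + 1) := by omega
      rify at l1 l2
      rw [Int.floor_eq_iff]
      constructor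
      · rw [le_sub_iff_add_le]
        refine Real.le_sqrt_of_sq_le ?_
        push_cast
        linarith
      · rw [sub_lt_iff_lt_add, Real.sqrt_lt' (by positivity)]
        push_cast
        linarith
    rw [hfloor]
    omega
  · intro k hk hk'
    rw [huniq k hk hk']
    omega
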